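/- Let $M$ be a compact smooth $d$-dimensional manifold without boundary, smoothly embedded in $\mathbb{R}^m$ and equipped with the Riemannian metric induced from $\mathbb{R}^m$. For $\mu\in M$ let $T_\mu M\subset\mathbb{R}^m$ be the tangent space (as a linear subspace), $B_{T_\mu M}(0,r)=\{v\in T_\mu M:\|v\|<r\}$, let $\mathrm{Exp}_\mu$ be the exponential map of $M$ at $\mu$, and let $B_M(\mu,r)=\mathrm{Exp}_\mu(B_{T_\mu M}(0,r))$ be the geodesic ball. A representative pair of radius $r$ at $\mu$ is a pair $(\mu, rT(\mu))$, where $T(\mu):\mathbb{R}^d\to\mathbb{R}^m$ is a linear isometry onto $T_\mu M$; it describes the affine tangent ball $H(\mu,r)=\{\mu+rT(\mu)\epsilon:\epsilon\in\mathbb{R}^d,\ \|\epsilon\|<1\}=\mu+B_{T_\mu M}(0,r)$. Then there are $r_0>0$ and a function $\omega$ with $\omega(r)=o(r)$ as $r\to0^+$, both depending only on the embedded manifold $M$, such that for every $0<r<r_0$ there are finitely many points $\mu_1,\dots,\mu_k\in M$ (the skeleton set) with representative pairs $(\mu_i,rT(\mu_i))$ such that $\mathrm{Exp}_{\mu_i}$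 is well defined and injective on $B_{T_{\mu_i}M}(0,r)$ for each $i$, $M=\bigcup_{i=1}^k B_M(\mu_i,r)$, and the representative pairs approximate $M$ with local error at most $\omega(r)$: for each $i$, $$\|\mathrm{Exp}_{\mu_i}(v)-(\mu_i+v)\|\le\omega(r)\quad\text{for all } v\in B_{T_{\mu_i}M}(0,r),$$ and the Hausdorff distance in $\mathbb{R}^m$ between $B_M(\mu_i,r)$ and $H(\mu_i,r)$ is at most $\omega(r)$. Consequently, the Hausdorff distance between $M$ and $\bigcup_{i=1}^k H(\mu_i,r)$ is at most $\omega(r)$ as well. -/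

import Mathlib

open Set Filter Topology Manifold
open scoped ContDiff Manifold

noncomputable section EmbeddedGeometry

variable {d m : ℕ} {M : Type*} [TopologicalSpace M] [ChartedSpace (EuclideanSpace ℝ (Fin d)) M]

/-- The tangent space of the embedded manifold `ι(M)` at `ι p`, as a linear subspace of `ℝ^m`. -/
def tangentPlane (ι : M → EuclideanSpace ℝ (Fin m)) (p : M) :
    Submodule ℝ (EuclideanSpace ℝ (Fin m)) :=
  LinearMap.range
    (mfderiv (𝓡 d) (𝓡 m) ι p :
      EuclideanSpace ℝ (Fin d) →L[ℝ] EuclideanSpace ℝ (Fin m)).toLinearMap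

/-- `γ` is, on `[0, 1]`, a geodesic of `M` for the metric induced from `ℝ^m`: it is smooth, and its
covariant acceleration, that is, the orthogonal projection of `(ι ∘ γ)''` onto the tangent space,
vanishes. -/
structure IsGeodesic (ι : M → EuclideanSpace ℝ (Fin m)) (γ : ℝ → M) : Prop where
  smooth : ∀ t ∈ Icc (0 : ℝ) 1, ContMDiffAt 𝓘(ℝ, ℝ) (𝓡 d) ∞ γ t
  acceleration : ∀ t ∈ Icc (0 : ℝ) 1,
    (tangentPlane (d := d) ι (γ t)).orthogonalProjectionOnto (deriv (deriv (ι ∘ γ)) t) = 0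

/-- `Exp_p(v) = q`: some geodesic starts at `p` with velocity `v` and is at `q` at time `1`. -/
def IsExp (ι : M → EuclideanSpace ℝ (Fin m)) (p : M) (v : EuclideanSpace ℝ (Fin m)) (q : M) :
    Prop :=
  ∃ γ : ℝ → M, IsGeodesic (d := d) ι γ ∧ γ 0 = p ∧ deriv (ι ∘ γ) 0 = v ∧ γ 1 = q

open Classical in
/-- The exponential map (with value `p` where it is not defined). -/
def expMap (ι : M → EuclideanSpace ℝ (Fin m)) (p : M) (v : EuclideanSpace ℝ (Fin m)) : M :=
  if h : ∃ q, IsExp (d := d) ι p v q then h.choose else p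

/-- The open ball of radius `r` about the origin in the tangent space at `p`. -/
def tangentBall (ι : M → EuclideanSpace ℝ (Fin m)) (p : M) (r : ℝ) :
    Set (EuclideanSpace ℝ (Fin m)) :=
  {v | v ∈ tangentPlane (d := d) ι p ∧ ‖v‖ < r}

/-- The geodesic ball of radius `r` about `p`. -/
def geodesicBall (ι : M → EuclideanSpace ℝ (Fin m)) (p : M) (r : ℝ) : Set M :=
  expMap (d := d) ι p '' tangentBall (d := d) ι p r

/-- `(p, A)` is a representative pair of radius `r`: `A = r T(p)`, where the linear map `T(p)` is
a linear isometry of `ℝ^d` onto the tangent space at `p`. -/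
def IsRepresentativePair (ι : M → EuclideanSpace ℝ (Fin m)) (r : ℝ) (p : M)
    (A : EuclideanSpace ℝ (Fin d) →ₗ[ℝ] EuclideanSpace ℝ (Fin m)) : Prop :=
  ∃ T : EuclideanSpace ℝ (Fin d) →ₗᵢ[ℝ] EuclideanSpace ℝ (Fin m),
    LinearMap.range T.toLinearMap = tangentPlane (d := d) ι p ∧ A = r • T.toLinearMap

/-- The region `{ι p + A ε : ε ∈ B(0, 1)}` described by the pair `(p, A)`. -/
def affineBall (ι : M → EuclideanSpace ℝ (Fin m)) (p : M)
    (A : EuclideanSpace ℝ (Fin d) →ₗ[ℝ] EuclideanSpace ℝ (Fin m)) :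
    Set (EuclideanSpace ℝ (Fin m)) :=
  (fun ε => ι p + A ε) '' Metric.ball 0 1

end EmbeddedGeometry

/-! In a chart, geodesics solve `u'' = B(u)(u', u')`. The right side is quadratic in the velocity,
so over unit time a geodesic of speed about `r` departs from uniform straight motion only by order
`r²`. `SolvesQuadraticODE.norm_sub_sub_le` makes this quantitative for two solutions from one point:
in coordinates, the exponential map differs from a translation by a map with small Lipschitz
constant. This single estimate yields uniqueness of the endpoint, injectivity, and, by the inverse
function argument, that geodesic balls are neighbourhoods. Comparison with the constant solution,
together with the Taylor expansion of the parametrization, bounds `Exp(v) - (p + v)` by a multiple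
of `r²`.

The definition of `IsExp` admits arbitrary geodesics, so none may be assumed to stay in a chart.
Constant speed gives this: `IsGeodesic.norm_sub_le` confines the curve to a Euclidean ball of radius
`‖v‖`, and since `ι` is a topological embedding, its points in a small Euclidean ball lie in one
chart.

`exists_nhds_expMap_estimates` collects the local estimates with constants uniform near a point.
Compactness makes them uniform on `M`, with error `C * r ^ 2`, and a second use of compactness
selects the skeleton for each `r`. -/

/-! ### Second order equations quadratic in the velocity. -/

section SecondOrderODE

variable {E : Type*} [NormedAddCommGroup E] [NormedSpace ℝ E]

/-- The pair `(u, s)` solves the second order equation `u' = s`, `s' = B(u)(s, s)` at time `t`. -/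
structure SolvesQuadraticODE (B : E → E →L[ℝ] E →L[ℝ] E) (u s : ℝ → E) (t : ℝ) : Prop where
  position : HasDerivAt u (s t) t
  velocity : HasDerivAt s (B (u t) (s t) (s t)) t

/-- Telescoping: first the coefficient changes, then each argument in turn, whence the factor 2. -/
lemma norm_bilin_sub_le {A B : E →L[ℝ] E →L[ℝ] E} {w z : E} {C ρ : ℝ}
    (hB : ‖B‖ ≤ C) (hw : ‖w‖ ≤ ρ) (hz : ‖z‖ ≤ ρ) :
    ‖A w w - B z z‖ ≤ ‖A - B‖ * ρ ^ 2 + 2 * C * ρ * ‖w - z‖ := by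
  have hρ : 0 ≤ ρ := (norm_nonneg _).trans hw
  have hC : 0 ≤ C := (norm_nonneg B).trans hB
  have e : A w w - B z z = (A - B) w w + (B (w - z) w + B z (w - z)) := by
    simp only [map_sub, sub_apply]; abel
  have h1 : ‖(A - B) w w‖ ≤ ‖A - B‖ * ρ * ρ :=
    ((A - B).le_opNorm₂ w w).trans (by gcongr)
  have h2 : ‖B (w - z) w‖ ≤ C * ‖w - z‖ * ρ := (B.le_opNorm₂ _ _).trans (by gcongr)
  have h3 : ‖B z (w - z)‖ ≤ C * ρ * ‖w - z‖ := (B.le_opNorm₂ _ _).trans (by gcongr)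
  rw [e]
  have h4 := norm_add_le ((A - B) w w) (B (w - z) w + B z (w - z))
  have h5 := norm_add_le (B (w - z) w) (B z (w - z))
  nlinarith

/-- Two slow solutions from the same point differ, at time `1`, by nearly the difference of
their initial velocities. -/
lemma SolvesQuadraticODE.norm_sub_sub_le {B : E → E →L[ℝ] E →L[ℝ] E} {S : Set E} {C L ρ : ℝ}
    (hC : ∀ x ∈ S, ‖B x‖ ≤ C) (hL : ∀ x ∈ S, ∀ y ∈ S, ‖B x - B y‖ ≤ L * ‖x - y‖)
    (hL0 : 0 ≤ L) (hρ1 : ρ ≤ 1) (hρ : (L + 2 * C) * ρ ≤ 1 / 2)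
    {u₁ s₁ u₂ s₂ : ℝ → E}
    (h₁ : ∀ t ∈ Icc (0 : ℝ) 1, SolvesQuadraticODE B u₁ s₁ t)
    (h₂ : ∀ t ∈ Icc (0 : ℝ) 1, SolvesQuadraticODE B u₂ s₂ t)
    (hS₁ : ∀ t ∈ Icc (0 : ℝ) 1, u₁ t ∈ S) (hS₂ : ∀ t ∈ Icc (0 : ℝ) 1, u₂ t ∈ S)
    (hs₁ : ∀ t ∈ Icc (0 : ℝ) 1, ‖s₁ t‖ ≤ ρ) (hs₂ : ∀ t ∈ Icc (0 : ℝ) 1, ‖s₂ t‖ ≤ ρ)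
    (h0 : u₁ 0 = u₂ 0) :
    ‖u₁ 1 - u₂ 1 - (s₁ 0 - s₂ 0)‖ ≤ 2 * (L + 2 * C) * ρ * ‖s₁ 0 - s₂ 0‖ := by
  have z0 : (0 : ℝ) ∈ Icc (0 : ℝ) 1 := by simp
  have hρ0 : 0 ≤ ρ := (norm_nonneg _).trans (hs₁ 0 z0)
  have hC0 : 0 ≤ C := (norm_nonneg (B (u₁ 0))).trans (hC _ (hS₁ 0 z0))
  have hcont : ContinuousOn (fun t => ‖s₁ t - s₂ t‖) (Icc (0 : ℝ) 1) := fun t ht =>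
    (((h₁ t ht).velocity.continuousAt.sub (h₂ t ht).velocity.continuousAt).norm).continuousWithinAt
  -- The largest velocity difference `D` replaces a Grönwall argument: the equation bounds `D` by
  -- the initial difference plus at most `D / 2`, which is absorbed.
  obtain ⟨τ, hτ, hmax⟩ := isCompact_Icc.exists_isMaxOn ⟨0, z0⟩ hcont
  set D := ‖s₁ τ - s₂ τ‖ with hD
  have hmax' : ∀ t ∈ Icc (0 : ℝ) 1, ‖s₁ t - s₂ t‖ ≤ D := fun t ht => hmax ht
  have hD0 : 0 ≤ D := norm_nonneg _
  have hu : ∀ t ∈ Icc (0 : ℝ) 1, ‖u₁ t - u₂ t‖ ≤ D := by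
    intro t ht
    have := norm_image_sub_le_of_norm_deriv_le_segment' (f := fun t => u₁ t - u₂ t)
      (fun x hx => ((h₁ x hx).position.sub (h₂ x hx).position).hasDerivWithinAt)
      (fun x hx => hmax' x (Ico_subset_Icc_self hx)) t ht
    simp only [h0, sub_self, sub_zero] at this
    nlinarith [ht.1, ht.2]
  have hs' : ∀ t ∈ Icc (0 : ℝ) 1,
      ‖B (u₁ t) (s₁ t) (s₁ t) - B (u₂ t) (s₂ t) (s₂ t)‖ ≤ (L + 2 * C) * ρ * D := by
    intro t ht
    have h3 := norm_bilin_sub_le (A := B (u₁ t)) (hC _ (hS₂ t ht)) (hs₁ t ht) (hs₂ t ht)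
    have h4 : ‖B (u₁ t) - B (u₂ t)‖ ≤ L * D :=
      (hL _ (hS₁ t ht) _ (hS₂ t ht)).trans (by gcongr; exact hu t ht)
    have h5 : ‖B (u₁ t) - B (u₂ t)‖ * ρ ^ 2 ≤ L * D * ρ := by
      have : ρ ^ 2 ≤ ρ := by nlinarith
      exact mul_le_mul h4 this (by positivity) (by positivity)
    have h6 : 2 * C * ρ * ‖s₁ t - s₂ t‖ ≤ 2 * C * ρ * D := by
      gcongr; exact hmax' t ht
    nlinarith
  have hs : ∀ t ∈ Icc (0 : ℝ) 1,
      ‖(s₁ t - s₂ t) - (s₁ 0 - s₂ 0)‖ ≤ (L + 2 * C) * ρ * D := by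
    intro t ht
    have := norm_image_sub_le_of_norm_deriv_le_segment' (f := fun t => s₁ t - s₂ t)
      (fun x hx => ((h₁ x hx).velocity.sub (h₂ x hx).velocity).hasDerivWithinAt)
      (fun x hx => hs' x (Ico_subset_Icc_self hx)) t ht
    refine this.trans ?_
    have : 0 ≤ (L + 2 * C) * ρ * D := by positivity
    nlinarith [ht.1, ht.2]
  have hDle : D ≤ 2 * ‖s₁ 0 - s₂ 0‖ := by
    have h3 := hs τ hτ
    have h4 : D ≤ ‖(s₁ τ - s₂ τ) - (s₁ 0 - s₂ 0)‖ + ‖s₁ 0 - s₂ 0‖ := by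
      simpa [hD] using norm_le_norm_sub_add (s₁ τ - s₂ τ) (s₁ 0 - s₂ 0)
    nlinarith
  -- Once uniform motion with the initial velocity difference is subtracted, the derivative is
  -- exactly the quantity bounded in `hs`.
  have hfin := norm_image_sub_le_of_norm_deriv_le_segment_01'
    (f := fun t => u₁ t - u₂ t - t • (s₁ 0 - s₂ 0))
    (fun x hx => (((h₁ x hx).position.sub (h₂ x hx).position).sub
      ((hasDerivAt_id x).smul_const (s₁ 0 - s₂ 0))).hasDerivWithinAt)
    (C := (L + 2 * C) * ρ * D)
    (fun x hx => by simpa using hs x (Ico_subset_Icc_self hx))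
  simp only [h0, sub_self, sub_zero, zero_smul, one_smul] at hfin
  refine hfin.trans ?_
  have : 0 ≤ (L + 2 * C) * ρ := by positivity
  nlinarith

lemma SolvesQuadraticODE.const (B : E → E →L[ℝ] E →L[ℝ] E) (x : E) (t : ℝ) :
    SolvesQuadraticODE B (fun _ => x) (fun _ => 0) t :=
  ⟨hasDerivAt_const _ _, by simpa using hasDerivAt_const t (0 : E)⟩

/-- Slow solutions exist on a neighbourhood of `[0, 1]`, are smooth and stay in a given ball. -/
lemma exists_solvesQuadraticODE [CompleteSpace E] {B : E → E →L[ℝ] E →L[ℝ] E} {x₀ : E} {R : ℝ}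
    (hR : 0 < R) (hB : ContDiffOn ℝ ∞ B (Metric.ball x₀ R)) :
    ∃ η > 0, ∀ x ∈ Metric.ball x₀ η, ∀ w : E, ‖w‖ < η →
      ∃ u s : ℝ → E, u 0 = x ∧ s 0 = w ∧ ∀ t ∈ Ioo (-1 : ℝ) 2,
        u t ∈ Metric.ball x₀ R ∧ SolvesQuadraticODE B u s t ∧ ContDiffAt ℝ ∞ u t := by
  set X : E × E → E × E := fun z => (z.2, B z.1 z.2 z.2) with hX
  have hXs : ContDiffOn ℝ ∞ X (Metric.ball x₀ R ×ˢ univ) := by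
    refine contDiffOn_snd.prodMk (ContDiffOn.clm_apply (ContDiffOn.clm_apply ?_ contDiffOn_snd)
      contDiffOn_snd)
    exact hB.comp contDiffOn_fst fun z hz => hz.1
  have hnhds : Metric.ball x₀ R ×ˢ (univ : Set E) ∈ 𝓝 ((x₀, 0) : E × E) :=
    (Metric.isOpen_ball.prod isOpen_univ).mem_nhds ⟨Metric.mem_ball_self hR, trivial⟩
  obtain ⟨K, S, hS, hK⟩ := ((hXs.contDiffAt hnhds).of_le
    (by exact_mod_cast le_top : (1 : WithTop ℕ∞) ≤ ∞)).exists_lipschitzOnWith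
  obtain ⟨a, ha, haS⟩ := Metric.nhds_basis_closedBall.mem_iff.1 (inter_mem hS hnhds)
  have hX0 : X (x₀, 0) = 0 := by simp [hX]
  have hXb : ∀ z ∈ Metric.closedBall ((x₀, 0) : E × E) a, ‖X z‖ ≤ K * a := by
    intro z hz
    have := hK.norm_sub_le (haS hz).1 (mem_of_mem_nhds hS)
    rw [hX0, sub_zero] at this
    exact this.trans (by gcongr; simpa [dist_eq_norm] using hz)
  -- The velocity is rescaled to `s / l`. As `B` is quadratic in `s`, the system becomes `z' = l • X
  -- z`, and this `l` is small enough that, over times up to 2, a curve starting within `a / 2` of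
  -- the centre cannot leave the ball of radius `a`. The interval `[-1, 2]` has `[0, 1]` in its
  -- interior.
  obtain ⟨l, hl⟩ : ∃ l : ℝ, l = 1 / (4 * (K + 1)) := ⟨_, rfl⟩
  have hl0 : 0 < l := by rw [hl]; positivity
  lift a to NNReal using ha.le
  lift l to NNReal using hl0.le
  have hpl : IsPicardLindelof (fun _ => fun z => (l : ℝ) • X z) (tmin := -1) (tmax := 2)
      ⟨0, by norm_num⟩ ((x₀, 0) : E × E) a (a / 2) (l * (K * a)) (l * K) := by
    refine IsPicardLindelof.of_time_independent ?_ ?_ ?_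
    · intro z hz
      rw [norm_smul]
      simpa using mul_le_mul_of_nonneg_left (hXb z hz) l.2
    · exact LipschitzOnWith.of_dist_le_mul fun z hz y hy => by
        rw [dist_smul₀]
        have := mul_le_mul_of_nonneg_left (hK.dist_le_mul z (haS hz).1 y (haS hy).1) l.2
        simpa [mul_assoc] using this
    · have h1 : max ((2 : ℝ) - 0) (0 - (-1)) = 2 := by norm_num
      push_cast
      rw [h1, hl]
      have hK0 : (0 : ℝ) ≤ K := K.2
      have ha0 : (0 : ℝ) ≤ a := a.2
      have h2 : (1 / (4 * ((K : ℝ) + 1)) * (K * a) * 2) = (K / (K + 1)) * (a / 2) := by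
        field_simp; ring
      have h3 : (K : ℝ) / (K + 1) ≤ 1 := by rw [div_le_one (by positivity)]; linarith
      rw [h2]
      nlinarith
  have ha' : (0 : ℝ) < a := ha
  have hl0' : (0 : ℝ) < l := hl0
  refine ⟨min (a / 2) (l * (a / 2)), by positivity, fun x hx w hw => ?_⟩
  have hz : ((x, (l : ℝ)⁻¹ • w) : E × E) ∈ Metric.closedBall (x₀, 0) ((a / 2 : NNReal) : ℝ) := by
    rw [Metric.mem_closedBall, Prod.dist_eq]
    refine max_le ?_ ?_
    · simpa using ((Metric.mem_ball.1 hx).trans_le (min_le_left _ _)).le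
    · rw [dist_zero_right, norm_smul, norm_inv, Real.norm_of_nonneg hl0'.le,
        inv_mul_le_iff₀ hl0']
      simpa using (hw.trans_le (min_le_right _ _)).le
  -- The fixed point of the Picard operator is used directly, since it also carries the confinement
  -- to the closed ball.
  obtain ⟨α, hα⟩ := ODE.FunSpace.exists_isFixedPt_next hpl hz
  have hmem : ∀ t, α.compProj t ∈ Metric.closedBall ((x₀, 0) : E × E) a := fun t =>
    α.compProj_mem_closedBall hpl.mul_max_le
  have hα0 : α.compProj 0 = (x, (l : ℝ)⁻¹ • w) := by
    have := ODE.FunSpace.next_apply₀ hpl hz α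
    rw [hα] at this
    rw [← this]
    exact ODE.FunSpace.compProj_val (t := ⟨0, by norm_num⟩)
  have hder : ∀ t ∈ Icc (-1 : ℝ) 2,
      HasDerivWithinAt α.compProj ((l : ℝ) • X (α.compProj t)) (Icc (-1 : ℝ) 2) t := by
    intro t ht
    refine (ODE.hasDerivWithinAt_picard_Icc (t₀ := 0) (by norm_num) hpl.continuousOn_uncurry
      α.continuous_compProj.continuousOn (fun _ _ => hmem _) (x, (l : ℝ)⁻¹ • w) ht).congr_of_mem
      (fun t' ht' => ?_) ht
    nth_rw 1 [← hα]
    rw [ODE.FunSpace.compProj_of_mem ht', ODE.FunSpace.next_apply]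
  have hsm : ContDiffOn ℝ ∞ α.compProj (Icc (-1 : ℝ) 2) := by
    refine ODE.contDiffOn_enat_Icc_of_hasDerivWithinAt (n := ⊤)
      (f := fun _ z => (l : ℝ) • X z) (u := Metric.ball x₀ R ×ˢ univ) ?_ hder
      (fun t _ => (haS (hmem t)).2)
    exact (hXs.comp contDiffOn_snd fun z hz => hz.2).const_smul (l : ℝ)
  generalize α.compProj = β at hmem hα0 hder hsm
  refine ⟨fun t => (β t).1, fun t => (l : ℝ) • (β t).2, by simp [hα0],
    by simp [hα0, smul_smul, hl0'.ne'], fun t ht => ?_⟩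
  have hI : Icc (-1 : ℝ) 2 ∈ 𝓝 t := Icc_mem_nhds ht.1 ht.2
  have hd := (hder t (Ioo_subset_Icc_self ht)).hasDerivAt hI
  refine ⟨(haS (hmem t)).2.1, ⟨?_, ?_⟩, (hsm.contDiffAt hI).fst⟩
  · exact (ContinuousLinearMap.fst ℝ E E).hasFDerivAt.comp_hasDerivAt t hd
  · have : HasDerivAt (fun t => (l : ℝ) • (β t).2) _ t :=
      ((ContinuousLinearMap.snd ℝ E E).hasFDerivAt.comp_hasDerivAt t hd).const_smul (l : ℝ)
    simpa [hX] using this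

end SecondOrderODE

/-! ### The geodesic equation of an induced metric. -/

section InducedConnection

variable {E F : Type*} [NormedAddCommGroup E] [InnerProductSpace ℝ E] [FiniteDimensional ℝ E]
  [NormedAddCommGroup F] [InnerProductSpace ℝ F] [FiniteDimensional ℝ F]

/-- The adjoint over `ℝ`, as a linear isometry. -/
noncomputable def realAdjoint : (E →L[ℝ] F) →ₗᵢ[ℝ] (F →L[ℝ] E) where
  toFun D := D.adjoint
  map_add' := by simp
  map_smul' := by simp
  norm_map' D := by simp

/-- The Gram operator of a linear map. -/
noncomputable def gramOperator (D : E →L[ℝ] F) : E →L[ℝ] E := (realAdjoint D).comp D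

/-- The coefficients `B` of the geodesic equation `u'' = B(u)(u', u')` of the metric induced by the
parametrization `φ`. -/
noncomputable def geodesicCoeff (φ : E → F) (x : E) : E →L[ℝ] E →L[ℝ] E :=
  -((ContinuousLinearMap.compL ℝ E F E
    ((gramOperator (fderiv ℝ φ x)).inverse.comp (realAdjoint (fderiv ℝ φ x)))).comp
      (fderiv ℝ (fderiv ℝ φ) x))

/-- Since `⟨D*D w, w⟩ = ‖D w‖²`, the kernel is trivial, which suffices in finite dimension. -/
lemma exists_equiv_gramOperator {D : E →L[ℝ] F} (hD : Function.Injective D) :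
    ∃ e : E ≃L[ℝ] E, (e : E →L[ℝ] E) = gramOperator D := by
  have hinj : Function.Injective (gramOperator D).toLinearMap := by
    refine (injective_iff_map_eq_zero _).2 fun w hw => hD ?_
    have h1 : inner ℝ (gramOperator D w) w = inner ℝ (D w) (D w) := by
      simp [gramOperator, realAdjoint, ContinuousLinearMap.adjoint_inner_left]
    have h2 : gramOperator D w = 0 := hw
    rw [h2, inner_zero_left, eq_comm, inner_self_eq_zero] at h1
    rw [h1, map_zero]
  refine ⟨(LinearEquiv.ofInjectiveEndo _ hinj).toContinuousLinearEquiv, ?_⟩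
  ext w
  rfl

/-- Operator inversion is smooth at invertible operators, and the Gram operator of an injective
derivative is invertible. -/
lemma contDiffOn_geodesicCoeff {φ : E → F} {V : Set E} (hV : IsOpen V)
    (hφ : ContDiffOn ℝ ∞ φ V) (hinj : ∀ x ∈ V, Function.Injective (fderiv ℝ φ x)) :
    ContDiffOn ℝ ∞ (geodesicCoeff φ) V := by
  intro x hx
  have h0 := hφ.contDiffAt (hV.mem_nhds hx)
  have h1 : ContDiffAt ℝ ∞ (fderiv ℝ φ) x := h0.fderiv_right (by simp)
  have h2 : ContDiffAt ℝ ∞ (fderiv ℝ (fderiv ℝ φ)) x := h1.fderiv_right (by simp)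
  have h3 : ContDiffAt ℝ ∞ (fun y => realAdjoint (fderiv ℝ φ y)) x :=
    (realAdjoint (E := E) (F := F)).contDiff.contDiffAt.comp x h1
  obtain ⟨e, he⟩ := exists_equiv_gramOperator (hinj x hx)
  have h4 : ContDiffAt ℝ ∞ (fun y => (gramOperator (fderiv ℝ φ y)).inverse) x := by
    have := contDiffAt_map_inverse (n := ∞) e
    rw [he] at this
    exact this.comp x (h3.clm_comp h1)
  refine ContDiffAt.contDiffWithinAt (ContDiffAt.neg ?_)
  exact ((ContinuousLinearMap.compL ℝ E F E).contDiff.contDiffAt.comp x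
    (h4.clm_comp h3)).clm_comp h2

/-- `b = B(x)(a, a')` says that `D²φ(a, a') + Dφ(b)` is orthogonal to the range of `Dφ`. -/
lemma eq_geodesicCoeff_iff {φ : E → F} {x : E} (hinj : Function.Injective (fderiv ℝ φ x))
    (a a' b : E) :
    b = geodesicCoeff φ x a a' ↔
      ∀ w, inner ℝ (fderiv ℝ φ x w) (fderiv ℝ (fderiv ℝ φ) x a a' + fderiv ℝ φ x b) = 0 := by
  obtain ⟨e, he⟩ := exists_equiv_gramOperator hinj
  set D := fderiv ℝ φ x with hD
  have h1 : geodesicCoeff φ x a a' = -(e.symm (realAdjoint D (fderiv ℝ (fderiv ℝ φ) x a a'))) := by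
    simp [geodesicCoeff, ← hD, ← he]
  -- Orthogonality to the range is membership in the kernel of the adjoint; this turns the condition
  -- into the normal equation for `b`.
  have h2 : (∀ w, inner ℝ (D w) (fderiv ℝ (fderiv ℝ φ) x a a' + D b) = 0) ↔
      realAdjoint D (fderiv ℝ (fderiv ℝ φ) x a a' + D b) = 0 := by
    refine ⟨fun h => ?_, fun h w => ?_⟩
    · refine ext_inner_left ℝ fun w => ?_
      rw [inner_zero_right, ← h w]
      exact ContinuousLinearMap.adjoint_inner_right D w _
    · rw [← ContinuousLinearMap.adjoint_inner_right D w]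
      have : D.adjoint (fderiv ℝ (fderiv ℝ φ) x a a' + D b) = 0 := h
      rw [this, inner_zero_right]
  have h3 : realAdjoint D (D b) = e b := by
    have := congrArg (fun f => f b) he
    exact this.symm
  rw [h2, h1, map_add, h3, ← map_neg, e.eq_symm_apply, eq_comm, eq_comm (b := (0 : E)),
    neg_eq_iff_add_eq_zero, eq_comm (a := (0 : E))]

end InducedConnection

/-! ### First and second derivatives along a curve. -/

section CurveDerivatives

variable {E F : Type*} [NormedAddCommGroup E] [NormedSpace ℝ E]
  [NormedAddCommGroup F] [NormedSpace ℝ F]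

lemma ContDiffAt.hasDerivAt_comp_curve {φ : E → F} {u : ℝ → E} {t : ℝ}
    (hφ : ContDiffAt ℝ ∞ φ (u t)) (hu : ContDiffAt ℝ ∞ u t) :
    HasDerivAt (φ ∘ u) (fderiv ℝ φ (u t) (deriv u t)) t :=
  (hφ.differentiableAt (by simp)).hasFDerivAt.comp_hasDerivAt t
    (hu.differentiableAt (by simp)).hasDerivAt

lemma ContDiffAt.hasDerivAt_deriv {u : ℝ → E} {t : ℝ} (hu : ContDiffAt ℝ ∞ u t) :
    HasDerivAt (deriv u) (deriv (deriv u) t) t := by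
  have h1 : ContDiffAt ℝ ∞ (fderiv ℝ u) t := hu.fderiv_right (by simp)
  have h2 : DifferentiableAt ℝ (fun x => fderiv ℝ u x 1) t :=
    (h1.clm_apply contDiffAt_const).differentiableAt (by simp)
  exact h2.hasDerivAt

lemma ContDiffAt.hasDerivAt_deriv_comp_curve {φ : E → F} {u : ℝ → E} {t : ℝ}
    (hφ : ContDiffAt ℝ ∞ φ (u t)) (hu : ContDiffAt ℝ ∞ u t) :
    HasDerivAt (deriv (φ ∘ u)) (fderiv ℝ (fderiv ℝ φ) (u t) (deriv u t) (deriv u t)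
      + fderiv ℝ φ (u t) (deriv (deriv u) t)) t := by
  have h1 : deriv (φ ∘ u) =ᶠ[𝓝 t] fun τ => fderiv ℝ φ (u τ) (deriv u τ) := by
    -- Being `C^∞` at a point need not persist nearby, because the neighbourhood may shrink with the
    -- order; being `C^1` does.
    have e1 : ∀ᶠ τ in 𝓝 t, ContDiffAt ℝ 1 u τ :=
      (hu.of_le (by exact_mod_cast le_top)).eventually (by simp)
    have e2 : ∀ᶠ τ in 𝓝 t, ContDiffAt ℝ 1 φ (u τ) := hu.continuousAt.eventually
      ((hφ.of_le (by exact_mod_cast le_top)).eventually (by simp))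
    filter_upwards [e1, e2] with τ h1 h2
    exact ((h2.differentiableAt (by simp)).hasFDerivAt.comp_hasDerivAt τ
      (h1.differentiableAt (by simp)).hasDerivAt).deriv
  have h2 : HasFDerivAt (fderiv ℝ φ) (fderiv ℝ (fderiv ℝ φ) (u t)) (u t) := by
    have : ContDiffAt ℝ ∞ (fderiv ℝ φ) (u t) := hφ.fderiv_right (by simp)
    exact (this.differentiableAt (by simp)).hasFDerivAt
  have h3 := (h2.comp_hasDerivAt t (hu.differentiableAt (by simp)).hasDerivAt).clm_apply
    hu.hasDerivAt_deriv
  exact h3.congr_of_eventuallyEq h1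

end CurveDerivatives

/-! ### Immersions and geodesics in charts. -/

section Embedded

variable {d m : ℕ} {M : Type*} [TopologicalSpace M] [ChartedSpace (EuclideanSpace ℝ (Fin d)) M]
  {ι : M → EuclideanSpace ℝ (Fin m)}

/-- An immersion has injective derivative. -/
lemma Manifold.IsImmersionAt.mfderiv_injective {p : M}
    (h : IsImmersionAt (𝓡 d) (𝓡 m) ∞ ι p) :
    Function.Injective (mfderiv (𝓡 d) (𝓡 m) ι p) := by
  set a := h.domChart.extend (𝓡 d) with ha
  set b := h.codChart.extend (𝓡 m) with hb
  -- In suitable charts the immersion is `w ↦ (w, 0)`, so the first projection yields a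
  -- differentiable local left inverse of `ι`.
  set pr : EuclideanSpace ℝ (Fin m) →L[ℝ] EuclideanSpace ℝ (Fin d) :=
    (ContinuousLinearMap.fst ℝ _ h.complement).comp
      (h.equiv.symm : EuclideanSpace ℝ (Fin m) →L[ℝ] EuclideanSpace ℝ (Fin d) × h.complement)
  have hleft : ∀ q ∈ h.domChart.source, pr (b (ι q)) = a q := by
    intro q hq
    have hqa : q ∈ a.source := by simpa [ha] using hq
    have hw := h.writtenInCharts (a.map_source hqa)
    simp only [Function.comp_apply, ← ha, ← hb, a.left_inv hqa] at hw
    simp [pr, hw]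
  have hsrc : h.domChart.source ∈ 𝓝 p := h.domChart.open_source.mem_nhds h.mem_domChart_source
  have hpa : p ∈ a.source := by simpa [ha] using h.mem_domChart_source
  have h1 : MDifferentiableAt (𝓡 m) 𝓘(ℝ, EuclideanSpace ℝ (Fin m)) b (ι p) :=
    (h.codChart.contMDiffAt_extend h.codChart_mem_maximalAtlas
      h.mem_codChart_source).mdifferentiableAt (by simp)
  have h2 : MDifferentiableAt 𝓘(ℝ, EuclideanSpace ℝ (Fin d)) (𝓡 d) a.symm (a p) := by
    have := contMDiffOn_extend_symm h.domChart_mem_maximalAtlas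
    rw [← h.domChart.extend_target'] at this
    exact (this.contMDiffAt ((h.domChart.isOpen_extend_target (I := 𝓡 d)).mem_nhds
      (a.map_source hpa))).mdifferentiableAt (by simp)
  have h3 : MDifferentiableAt (𝓡 m) 𝓘(ℝ, EuclideanSpace ℝ (Fin d)) (pr ∘ b) (ι p) :=
    pr.mdifferentiableAt.comp (ι p) h1
  have h4 : MDifferentiableAt (𝓡 m) (𝓡 d) (a.symm ∘ (pr ∘ b)) (ι p) := by
    refine MDifferentiableAt.comp (ι p) ?_ h3
    simpa [hleft p h.mem_domChart_source] using h2
  have h5 : MDifferentiableAt (𝓡 d) (𝓡 m) ι p := h.contMDiffAt.mdifferentiableAt (by simp)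
  have h6 : (a.symm ∘ (pr ∘ b)) ∘ ι =ᶠ[𝓝 p] id := by
    filter_upwards [hsrc] with q hq
    simp [hleft q hq, a.left_inv (show q ∈ a.source by simpa [ha] using hq)]
  have h7 := mfderiv_comp p h4 h5
  rw [h6.mfderiv_eq, mfderiv_id] at h7
  exact Function.LeftInverse.injective (g := mfderiv (𝓡 m) (𝓡 d) (a.symm ∘ (pr ∘ b)) (ι p))
    fun w => (DFunLike.congr_fun h7 w).symm

/-- The parametrization of the embedded manifold given by the chart at `p₀`. -/
noncomputable def chartParam (ι : M → EuclideanSpace ℝ (Fin m)) (p₀ : M) :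
    EuclideanSpace ℝ (Fin d) → EuclideanSpace ℝ (Fin m) :=
  ι ∘ (extChartAt (𝓡 d) p₀).symm

lemma chartParam_extChartAt {p₀ q : M} (hq : q ∈ (extChartAt (𝓡 d) p₀).source) :
    chartParam ι p₀ (extChartAt (𝓡 d) p₀ q) = ι q := by
  rw [chartParam, Function.comp_apply, (extChartAt (𝓡 d) p₀).left_inv hq]

lemma comp_eventuallyEq_chartParam {p₀ : M} {γ : ℝ → M} {t : ℝ}
    (hγ : ContinuousAt γ t) (ht : γ t ∈ (extChartAt (𝓡 d) p₀).source) :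
    ι ∘ γ =ᶠ[𝓝 t] chartParam ι p₀ ∘ (extChartAt (𝓡 d) p₀ ∘ γ) := by
  filter_upwards [hγ.eventually ((isOpen_extChartAt_source p₀).mem_nhds ht)] with τ hτ
  exact (chartParam_extChartAt hτ).symm

lemma IsGeodesic.contDiffAt_comp (hι : ContMDiff (𝓡 d) (𝓡 m) ∞ ι) {γ : ℝ → M}
    (hγ : IsGeodesic (d := d) ι γ) {t : ℝ} (ht : t ∈ Icc (0 : ℝ) 1) :
    ContDiffAt ℝ ∞ (ι ∘ γ) t :=
  (hι.contMDiffAt.comp t (hγ.smooth t ht)).contDiffAt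

variable [IsManifold (𝓡 d) ∞ M]

lemma contDiffOn_chartParam (hι : ContMDiff (𝓡 d) (𝓡 m) ∞ ι) (p₀ : M) :
    ContDiffOn ℝ ∞ (chartParam ι p₀) (extChartAt (𝓡 d) p₀).target :=
  contMDiffOn_iff_contDiffOn.1 (hι.comp_contMDiffOn (contMDiffOn_extChartAt_symm p₀))

lemma contDiffAt_chartParam (hι : ContMDiff (𝓡 d) (𝓡 m) ∞ ι) {p₀ : M}
    {x : EuclideanSpace ℝ (Fin d)} (hx : x ∈ (extChartAt (𝓡 d) p₀).target) :
    ContDiffAt ℝ ∞ (chartParam ι p₀) x :=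
  (contDiffOn_chartParam hι p₀).contDiffAt ((isOpen_extChartAt_target p₀).mem_nhds hx)

lemma mfderiv_eq_fderiv_chartParam_comp (hι : ContMDiff (𝓡 d) (𝓡 m) ∞ ι) {p₀ q : M}
    (hq : q ∈ (extChartAt (𝓡 d) p₀).source) :
    mfderiv (𝓡 d) (𝓡 m) ι q = (fderiv ℝ (chartParam ι p₀) (extChartAt (𝓡 d) p₀ q)).comp
      (mfderiv (𝓡 d) 𝓘(ℝ, EuclideanSpace ℝ (Fin d)) (extChartAt (𝓡 d) p₀) q) := by
  have h1 : ι =ᶠ[𝓝 q] chartParam ι p₀ ∘ extChartAt (𝓡 d) p₀ := by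
    filter_upwards [(isOpen_extChartAt_source p₀).mem_nhds hq] with y hy
    exact (chartParam_extChartAt hy).symm
  have h2 := (contDiffAt_chartParam hι ((extChartAt (𝓡 d) p₀).map_source hq)).differentiableAt
    (by simp)
  have hq' : q ∈ (chartAt (EuclideanSpace ℝ (Fin d)) p₀).source := by simpa using hq
  rw [h1.mfderiv_eq, mfderiv_comp q h2.mdifferentiableAt
    ((contMDiffAt_extChartAt' (n := ∞) hq').mdifferentiableAt (by simp)), mfderiv_eq_fderiv]
  rfl

/-- The derivative of the chart is surjective, so composing with it does not change the range. -/
lemma tangentPlane_eq_range (hι : ContMDiff (𝓡 d) (𝓡 m) ∞ ι) {p₀ q : M}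
    (hq : q ∈ (extChartAt (𝓡 d) p₀).source) :
    tangentPlane (d := d) ι q =
      LinearMap.range (fderiv ℝ (chartParam ι p₀) (extChartAt (𝓡 d) p₀ q)).toLinearMap := by
  have : IsManifold (𝓡 d) 1 M := .of_le (n := ∞) (by exact_mod_cast le_top)
  obtain ⟨e, he⟩ := isInvertible_mfderiv_extChartAt (I := 𝓡 d) hq
  rw [tangentPlane, mfderiv_eq_fderiv_chartParam_comp hι hq]
  refine (LinearMap.range_comp_of_range_eq_top _ ?_)
  rw [← he]
  exact LinearMap.range_eq_top.2 e.surjective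

lemma injective_fderiv_chartParam (hι : IsImmersion (𝓡 d) (𝓡 m) ∞ ι) {p₀ : M}
    {x : EuclideanSpace ℝ (Fin d)} (hx : x ∈ (extChartAt (𝓡 d) p₀).target) :
    Function.Injective (fderiv ℝ (chartParam ι p₀) x) := by
  have : IsManifold (𝓡 d) 1 M := .of_le (n := ∞) (by exact_mod_cast le_top)
  obtain ⟨q, hq, rfl⟩ : ∃ q ∈ (extChartAt (𝓡 d) p₀).source, extChartAt (𝓡 d) p₀ q = x :=
    ⟨_, (extChartAt (𝓡 d) p₀).map_target hx, (extChartAt (𝓡 d) p₀).right_inv hx⟩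
  obtain ⟨e, he⟩ := isInvertible_mfderiv_extChartAt (I := 𝓡 d) hq
  have h1 := (hι.isImmersionAt q).mfderiv_injective
  rw [mfderiv_eq_fderiv_chartParam_comp hι.contMDiff hq, ← he] at h1
  exact (Function.Injective.of_comp_iff' _ e.bijective).1 h1

lemma contDiffAt_extChartAt_comp {p₀ : M} {γ : ℝ → M} {t : ℝ}
    (hγ : ContMDiffAt 𝓘(ℝ, ℝ) (𝓡 d) ∞ γ t) (ht : γ t ∈ (extChartAt (𝓡 d) p₀).source) :
    ContDiffAt ℝ ∞ (extChartAt (𝓡 d) p₀ ∘ γ) t := by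
  have ht' : γ t ∈ (chartAt (EuclideanSpace ℝ (Fin d)) p₀).source := by simpa using ht
  exact ((contMDiffAt_extChartAt' ht').comp t hγ).contDiffAt

/-- In a chart, the covariant acceleration vanishes iff the geodesic equation holds. -/
lemma acceleration_eq_zero_iff (hι : IsImmersion (𝓡 d) (𝓡 m) ∞ ι) {p₀ : M} {γ : ℝ → M} {t : ℝ}
    {u : ℝ → EuclideanSpace ℝ (Fin d)} (hu : ContDiffAt ℝ ∞ u t)
    (hx : γ t ∈ (extChartAt (𝓡 d) p₀).source) (hut : u t = extChartAt (𝓡 d) p₀ (γ t))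
    (heq : ι ∘ γ =ᶠ[𝓝 t] chartParam ι p₀ ∘ u) :
    (tangentPlane (d := d) ι (γ t)).orthogonalProjectionOnto (deriv (deriv (ι ∘ γ)) t) = 0 ↔
      deriv (deriv u) t = geodesicCoeff (chartParam ι p₀) (u t) (deriv u t) (deriv u t) := by
  have hxt : u t ∈ (extChartAt (𝓡 d) p₀).target := hut ▸ (extChartAt (𝓡 d) p₀).map_source hx
  rw [eq_geodesicCoeff_iff (injective_fderiv_chartParam hι hxt),
    Submodule.orthogonalProjectionOnto_eq_zero_iff, tangentPlane_eq_range hι.contMDiff hx, ← hut,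
    heq.deriv.deriv_eq,
    ((contDiffAt_chartParam hι.contMDiff hxt).hasDerivAt_deriv_comp_curve hu).deriv,
    Submodule.mem_orthogonal]
  exact ⟨fun h w => h _ ⟨w, rfl⟩, by rintro h _ ⟨w, rfl⟩; exact h w⟩

namespace IsGeodesic

/-- A geodesic solves the geodesic equation in every chart. -/
lemma solvesQuadraticODE (hι : IsImmersion (𝓡 d) (𝓡 m) ∞ ι) {γ : ℝ → M}
    (hγ : IsGeodesic (d := d) ι γ) {p₀ : M} {t : ℝ} (ht : t ∈ Icc (0 : ℝ) 1)
    (hx : γ t ∈ (extChartAt (𝓡 d) p₀).source) :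
    SolvesQuadraticODE (geodesicCoeff (chartParam ι p₀)) (extChartAt (𝓡 d) p₀ ∘ γ)
      (deriv (extChartAt (𝓡 d) p₀ ∘ γ)) t := by
  have hu := contDiffAt_extChartAt_comp (hγ.smooth t ht) hx
  refine ⟨(hu.differentiableAt (by simp)).hasDerivAt, ?_⟩
  rw [← (acceleration_eq_zero_iff hι hu hx rfl
    (comp_eventuallyEq_chartParam (hγ.smooth t ht).continuousAt hx)).1 (hγ.acceleration t ht)]
  exact hu.hasDerivAt_deriv

lemma hasDerivAt (hι : ContMDiff (𝓡 d) (𝓡 m) ∞ ι) {γ : ℝ → M}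
    (hγ : IsGeodesic (d := d) ι γ) {p₀ : M} {t : ℝ} (ht : t ∈ Icc (0 : ℝ) 1)
    (hx : γ t ∈ (extChartAt (𝓡 d) p₀).source) :
    HasDerivAt (ι ∘ γ) (fderiv ℝ (chartParam ι p₀) (extChartAt (𝓡 d) p₀ (γ t))
      (deriv (extChartAt (𝓡 d) p₀ ∘ γ) t)) t :=
  ((contDiffAt_chartParam hι ((extChartAt (𝓡 d) p₀).map_source hx)).hasDerivAt_comp_curve
    (u := extChartAt (𝓡 d) p₀ ∘ γ)
    (contDiffAt_extChartAt_comp (hγ.smooth t ht) hx)).congr_of_eventuallyEq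
      (comp_eventuallyEq_chartParam (hγ.smooth t ht).continuousAt hx)

lemma deriv_mem_tangentPlane (hι : ContMDiff (𝓡 d) (𝓡 m) ∞ ι) {γ : ℝ → M}
    (hγ : IsGeodesic (d := d) ι γ) {t : ℝ} (ht : t ∈ Icc (0 : ℝ) 1) :
    deriv (ι ∘ γ) t ∈ tangentPlane (d := d) ι (γ t) := by
  have hx := mem_extChartAt_source (I := 𝓡 d) (γ t)
  rw [(hγ.hasDerivAt hι ht hx).deriv, tangentPlane_eq_range hι hx]
  exact ⟨_, rfl⟩

/-- Geodesics have constant speed. -/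
lemma norm_deriv_eq (hι : ContMDiff (𝓡 d) (𝓡 m) ∞ ι) {γ : ℝ → M}
    (hγ : IsGeodesic (d := d) ι γ) {t : ℝ} (ht : t ∈ Icc (0 : ℝ) 1) :
    ‖deriv (ι ∘ γ) t‖ = ‖deriv (ι ∘ γ) 0‖ := by
  -- The derivative is `2⟨γ', γ''⟩`, where `γ'` is tangent and `γ''` is normal to the surface.
  have h1 : ∀ τ ∈ Icc (0 : ℝ) 1, HasDerivAt (fun τ => ‖deriv (ι ∘ γ) τ‖ ^ 2) 0 τ := by
    intro τ hτ
    have h2 := (hγ.contDiffAt_comp hι hτ).hasDerivAt_deriv.norm_sq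
    have h3 := Submodule.orthogonalProjectionOnto_eq_zero_iff.1 (hγ.acceleration τ hτ)
    rwa [h3 _ (hγ.deriv_mem_tangentPlane hι hτ), mul_zero] at h2
  have h2 := norm_image_sub_le_of_norm_deriv_le_segment' (C := 0)
    (fun τ hτ => (h1 τ hτ).hasDerivWithinAt) (by simp) t ht
  rw [zero_mul, norm_le_zero_iff, sub_eq_zero] at h2
  exact (pow_left_inj₀ (norm_nonneg _) (norm_nonneg _) two_ne_zero).1 h2

/-- The chord is at most the length. This bound needs no chart and is what later keeps geodesics
inside one. -/
lemma norm_sub_le (hι : ContMDiff (𝓡 d) (𝓡 m) ∞ ι) {γ : ℝ → M}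
    (hγ : IsGeodesic (d := d) ι γ) {t : ℝ} (ht : t ∈ Icc (0 : ℝ) 1) :
    ‖ι (γ t) - ι (γ 0)‖ ≤ ‖deriv (ι ∘ γ) 0‖ := by
  have := norm_image_sub_le_of_norm_deriv_le_segment' (f := ι ∘ γ)
    (fun τ hτ => ((hγ.contDiffAt_comp hι hτ).differentiableAt (by simp)).hasDerivAt.hasDerivWithinAt)
    (fun τ hτ => (hγ.norm_deriv_eq hι (Ico_subset_Icc_self hτ)).le) t ht
  refine this.trans ?_
  nlinarith [ht.1, ht.2, norm_nonneg (deriv (ι ∘ γ) 0)]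

end IsGeodesic

/-- A smooth solution of the geodesic equation in a chart gives a geodesic. -/
lemma isGeodesic_of_solvesQuadraticODE (hι : IsImmersion (𝓡 d) (𝓡 m) ∞ ι) {p₀ : M}
    {u s : ℝ → EuclideanSpace ℝ (Fin d)} {J : Set ℝ} (hJ : IsOpen J) (hIJ : Icc (0 : ℝ) 1 ⊆ J)
    (hmem : ∀ t ∈ J, u t ∈ (extChartAt (𝓡 d) p₀).target)
    (hode : ∀ t ∈ J, SolvesQuadraticODE (geodesicCoeff (chartParam ι p₀)) u s t)
    (hu : ∀ t ∈ J, ContDiffAt ℝ ∞ u t) :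
    IsGeodesic (d := d) ι ((extChartAt (𝓡 d) p₀).symm ∘ u) := by
  refine ⟨fun t ht => ?_, fun t ht => ?_⟩
  · have h1 := (contMDiffOn_extChartAt_symm (n := ∞) p₀).contMDiffAt
      ((isOpen_extChartAt_target (I := 𝓡 d) p₀).mem_nhds (hmem t (hIJ ht)))
    exact h1.comp t (hu t (hIJ ht)).contMDiffAt
  · have hx := (extChartAt (𝓡 d) p₀).map_target (hmem t (hIJ ht))
    have h1 : deriv u =ᶠ[𝓝 t] s := by
      filter_upwards [hJ.mem_nhds (hIJ ht)] with τ hτ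
      exact (hode τ hτ).position.deriv
    refine (acceleration_eq_zero_iff hι (hu t (hIJ ht)) hx
      ((extChartAt (𝓡 d) p₀).right_inv (hmem t (hIJ ht))).symm EventuallyEq.rfl).2 ?_
    rw [h1.deriv_eq, h1.eq_of_nhds, (hode t (hIJ ht)).velocity.deriv]

end Embedded

/-! ### Uniform bounds in a chart. -/

section ChartBounds

variable {E F : Type*} [NormedAddCommGroup E] [InnerProductSpace ℝ E] [FiniteDimensional ℝ E]
  [NormedAddCommGroup F] [InnerProductSpace ℝ F] [FiniteDimensional ℝ F]

/-- Uniform bounds on a set for a parametrization and its geodesic equation. -/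
structure ChartBounds (φ : E → F) (S : Set E) (a C L : ℝ) : Prop where
  pos : 0 < a
  lipschitz_nonneg : 0 ≤ L
  lower : ∀ x ∈ S, ∀ w, a * ‖w‖ ≤ ‖fderiv ℝ φ x w‖
  fderiv_le : ∀ x ∈ S, ‖fderiv ℝ φ x‖ ≤ C
  coeff_le : ∀ x ∈ S, ‖geodesicCoeff φ x‖ ≤ C
  fderiv_sub_le : ∀ x ∈ S, ∀ y ∈ S, ‖fderiv ℝ φ x - fderiv ℝ φ y‖ ≤ L * ‖x - y‖
  coeff_sub_le : ∀ x ∈ S, ∀ y ∈ S, ‖geodesicCoeff φ x - geodesicCoeff φ y‖ ≤ L * ‖x - y‖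

/-- Each bound holds at the centre by smoothness or injectivity, and survives on a small ball after
loosening the constant: the lower bound is halved, the upper bounds grow by 1. -/
lemma exists_chartBounds {φ : E → F} {V : Set E} (hV : IsOpen V) (hφ : ContDiffOn ℝ ∞ φ V)
    (hinj : ∀ x ∈ V, Function.Injective (fderiv ℝ φ x)) {x₀ : E} (hx₀ : x₀ ∈ V) :
    ∃ R > 0, Metric.ball x₀ R ⊆ V ∧ ∃ a C L : ℝ, ChartBounds φ (Metric.ball x₀ R) a C L := by
  have hD : ContDiffAt ℝ ∞ (fderiv ℝ φ) x₀ :=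
    (hφ.contDiffAt (hV.mem_nhds hx₀)).fderiv_right (by simp)
  have hB := (contDiffOn_geodesicCoeff hV hφ hinj).contDiffAt (hV.mem_nhds hx₀)
  obtain ⟨L₁, S₁, hS₁, hL₁⟩ := (hD.of_le
    (by exact_mod_cast le_top : (1 : WithTop ℕ∞) ≤ ∞)).exists_lipschitzOnWith
  obtain ⟨L₂, S₂, hS₂, hL₂⟩ := (hB.of_le
    (by exact_mod_cast le_top : (1 : WithTop ℕ∞) ≤ ∞)).exists_lipschitzOnWith
  obtain ⟨k, hk, hka⟩ := (fderiv ℝ φ x₀).toLinearMap.exists_antilipschitzWith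
    (LinearMap.ker_eq_bot.2 (hinj x₀ hx₀))
  have hk' : (0 : ℝ) < k := hk
  have hlow : ∀ w, (k : ℝ)⁻¹ * ‖w‖ ≤ ‖fderiv ℝ φ x₀ w‖ := fun w => by
    rw [inv_mul_le_iff₀ hk']
    simpa [dist_eq_norm] using hka.le_mul_dist w 0
  have e1 := hD.continuousAt.norm.eventually (gt_mem_nhds (lt_add_one ‖fderiv ℝ φ x₀‖))
  have e2 : ∀ᶠ x in 𝓝 x₀, ‖geodesicCoeff φ x‖ < ‖geodesicCoeff φ x₀‖ + 1 :=
    ((continuous_norm (E := E →L[ℝ] E →L[ℝ] E)).continuousAt.comp hB.continuousAt).eventually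
      (gt_mem_nhds (lt_add_one ‖geodesicCoeff φ x₀‖))
  have e3 := hD.continuousAt.eventually (Metric.ball_mem_nhds (fderiv ℝ φ x₀)
    (show (0 : ℝ) < (k : ℝ)⁻¹ / 2 by positivity))
  obtain ⟨R, hR, hRS⟩ := Metric.mem_nhds_iff.1
    (inter_mem (inter_mem hS₁ hS₂) (inter_mem (hV.mem_nhds hx₀) (e1.and (e2.and e3))))
  refine ⟨R, hR, fun x hx => (hRS hx).2.1, (k : ℝ)⁻¹ / 2,
    max (‖fderiv ℝ φ x₀‖ + 1) (‖geodesicCoeff φ x₀‖ + 1), max L₁ L₂, by positivity,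
    le_max_of_le_left L₁.2, fun x hx w => ?_,
    fun x hx => (hRS hx).2.2.1.le.trans (le_max_left _ _),
    fun x hx => (hRS hx).2.2.2.1.le.trans (le_max_right _ _), fun x hx y hy => ?_,
    fun x hx y hy => ?_⟩
  · have h1 : ‖fderiv ℝ φ x - fderiv ℝ φ x₀‖ < (k : ℝ)⁻¹ / 2 := by
      simpa [dist_eq_norm] using (hRS hx).2.2.2.2
    have h2 := (fderiv ℝ φ x - fderiv ℝ φ x₀).le_of_opNorm_le h1.le w
    have h3 : ‖fderiv ℝ φ x₀ w‖ ≤ ‖fderiv ℝ φ x w‖ + ‖(fderiv ℝ φ x - fderiv ℝ φ x₀) w‖ := by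
      simpa using norm_sub_le (fderiv ℝ φ x w) ((fderiv ℝ φ x - fderiv ℝ φ x₀) w)
    linarith [hlow w]
  · exact (hL₁.norm_sub_le (hRS hx).1.1 (hRS hy).1.1).trans (by gcongr; exact le_max_left _ _)
  · exact (hL₂.norm_sub_le (hRS hx).1.2 (hRS hy).1.2).trans (by gcongr; exact le_max_right _ _)

/-- A Lipschitz derivative gives a quadratic Taylor remainder, by the mean value inequality on the
segment. -/
lemma ChartBounds.norm_image_sub_sub_le {φ : E → F} {S : Set E} {a C L : ℝ}
    (h : ChartBounds φ S a C L) (hS : Convex ℝ S) (hφ : ∀ x ∈ S, DifferentiableAt ℝ φ x)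
    {x y : E} (hx : x ∈ S) (hy : y ∈ S) :
    ‖φ y - φ x - fderiv ℝ φ x (y - x)‖ ≤ L * ‖y - x‖ * ‖y - x‖ := by
  have hseg := hS.segment_subset hx hy
  refine Convex.norm_image_sub_le_of_norm_hasFDerivWithin_le' (s := segment ℝ x y)
    (fun z hz => (hφ z (hseg hz)).hasFDerivAt.hasFDerivWithinAt) (fun z hz => ?_)
    (convex_segment x y) (left_mem_segment ℝ x y) (right_mem_segment ℝ x y)
  refine (h.fderiv_sub_le z (hseg hz) x hx).trans ?_
  have := norm_sub_le_of_mem_segment hz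
  have := h.lipschitz_nonneg
  gcongr

end ChartBounds

/-! ### The exponential map near a point. -/

section LocalExponential

variable {d m : ℕ} {M : Type*} [TopologicalSpace M] [ChartedSpace (EuclideanSpace ℝ (Fin d)) M]
  {ι : M → EuclideanSpace ℝ (Fin m)}

lemma isExp_expMap {p : M} {v : EuclideanSpace ℝ (Fin m)}
    (h : ∃ q, IsExp (d := d) ι p v q) : IsExp (d := d) ι p v (expMap (d := d) ι p v) := by
  rw [expMap, dif_pos h]
  exact h.choose_spec

variable [IsManifold (𝓡 d) ∞ M]

/-- The chart representation of a geodesic which stays in a set with uniform bounds. -/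
lemma exists_chart_solution_of_isExp (hι : IsImmersion (𝓡 d) (𝓡 m) ∞ ι) {p₀ p q : M}
    {v : EuclideanSpace ℝ (Fin m)} {S : Set (EuclideanSpace ℝ (Fin d))} {a C L : ℝ}
    (hb : ChartBounds (chartParam ι p₀) S a C L)
    (hS : ∀ y, ‖ι y - ι p‖ ≤ ‖v‖ → y ∈ (extChartAt (𝓡 d) p₀).source ∧ extChartAt (𝓡 d) p₀ y ∈ S)
    (h : IsExp (d := d) ι p v q) :
    ∃ u s : ℝ → EuclideanSpace ℝ (Fin d), u 0 = extChartAt (𝓡 d) p₀ p ∧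
      u 1 = extChartAt (𝓡 d) p₀ q ∧
      fderiv ℝ (chartParam ι p₀) (extChartAt (𝓡 d) p₀ p) (s 0) = v ∧
      (∀ t ∈ Icc (0 : ℝ) 1, SolvesQuadraticODE (geodesicCoeff (chartParam ι p₀)) u s t) ∧
      (∀ t ∈ Icc (0 : ℝ) 1, u t ∈ S) ∧ ∀ t ∈ Icc (0 : ℝ) 1, ‖s t‖ ≤ ‖v‖ / a := by
  obtain ⟨γ, hγ, h0, hv, h1⟩ := h
  have z0 : (0 : ℝ) ∈ Icc (0 : ℝ) 1 := by simp
  have hmem : ∀ t ∈ Icc (0 : ℝ) 1, γ t ∈ (extChartAt (𝓡 d) p₀).source ∧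
      extChartAt (𝓡 d) p₀ (γ t) ∈ S := fun t ht => hS _ (by
    rw [← hv, ← h0]; exact hγ.norm_sub_le hι.contMDiff ht)
  refine ⟨extChartAt (𝓡 d) p₀ ∘ γ, deriv (extChartAt (𝓡 d) p₀ ∘ γ), by simp [h0], by simp [h1], ?_,
    fun t ht => hγ.solvesQuadraticODE hι ht (hmem t ht).1, fun t ht => (hmem t ht).2,
    fun t ht => ?_⟩
  · rw [← hv, (hγ.hasDerivAt hι.contMDiff z0 (hmem 0 z0).1).deriv, h0]
  -- The lower bound on the derivative converts constant ambient speed into a bound on coordinate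
  -- velocity.
  · rw [le_div_iff₀ hb.pos, mul_comm, ← hv, ← hγ.norm_deriv_eq hι.contMDiff ht,
      (hγ.hasDerivAt hι.contMDiff ht (hmem t ht).1).deriv]
    exact hb.lower _ (hmem t ht).2 _

/-- Near a point of the embedded manifold the exponential map is well defined and injective on
small balls, its images are neighbourhoods, and it is tangent to the identity to second order, all
with uniform constants. -/
lemma exists_nhds_expMap_estimates (hι : IsSmoothEmbedding (𝓡 d) (𝓡 m) ∞ ι) (p₀ : M) :
    ∃ U ∈ 𝓝 p₀, ∃ r₀ > 0, ∃ K : ℝ, ∀ p ∈ U, ∀ r : ℝ, 0 < r → r < r₀ →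
      (∀ v ∈ tangentBall (d := d) ι p r, ∃! q, IsExp (d := d) ι p v q) ∧
      InjOn (expMap (d := d) ι p) (tangentBall (d := d) ι p r) ∧
      geodesicBall (d := d) ι p r ∈ 𝓝 p ∧
      ∀ v ∈ tangentBall (d := d) ι p r, ‖ι (expMap (d := d) ι p v) - (ι p + v)‖ ≤ K * r ^ 2 := by
  have him := hι.isImmersion
  have hs := him.contMDiff
  set e := extChartAt (𝓡 d) p₀ with he
  set φ := chartParam (d := d) ι p₀ with hφ
  obtain ⟨R, hR, hRV, a, C, L, hb⟩ := exists_chartBounds (isOpen_extChartAt_target p₀)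
    (contDiffOn_chartParam hs p₀) (fun x hx => injective_fderiv_chartParam him hx)
    (mem_extChartAt_target (I := 𝓡 d) p₀)
  rw [← hφ, ← he] at hb
  obtain ⟨η, hη, hex⟩ := exists_solvesQuadraticODE hR ((contDiffOn_geodesicCoeff
    (isOpen_extChartAt_target p₀) (contDiffOn_chartParam hs p₀)
    (fun x hx => injective_fderiv_chartParam him hx)).mono hRV)
  obtain ⟨δ, hδ, hδS⟩ : ∃ δ > 0, ∀ y, dist (ι y) (ι p₀) < δ →
      y ∈ e.source ∧ e y ∈ Metric.ball (e p₀) (min R η) := by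
    have h1 : e.source ∩ e ⁻¹' Metric.ball (e p₀) (min R η) ∈ 𝓝 p₀ :=
      inter_mem (extChartAt_source_mem_nhds p₀)
        ((continuousAt_extChartAt p₀).preimage_mem_nhds (Metric.ball_mem_nhds _ (lt_min hR hη)))
    rw [hι.isEmbedding.isInducing.nhds_eq_comap] at h1
    obtain ⟨δ, hδ, h2⟩ := (Metric.nhds_basis_ball.comap ι).mem_iff.1 h1
    exact ⟨δ, hδ, fun y hy => h2 hy⟩
  have ha := hb.pos
  have hL := hb.lipschitz_nonneg
  have hC : 0 ≤ C := (norm_nonneg _).trans (hb.fderiv_le (e p₀) (Metric.mem_ball_self hR))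
  set Q := L + 2 * C with hQ
  have hQ0 : 0 ≤ Q := by positivity
  -- The four radii serve, in order: `δ / 2` to stay in the chart, `a * η` for existence, `a` for `r
  -- / a ≤ 1`, and the last for `Q * (r / a) ≤ 1 / 4`. In the error constant, `4 * L` comes from the
  -- Taylor remainder and `2 * Q * C` from the equation.
  refine ⟨ι ⁻¹' Metric.ball (ι p₀) (δ / 2),
    hs.continuous.continuousAt.preimage_mem_nhds (Metric.ball_mem_nhds _ (by positivity)),
    min (min (δ / 2) (a * η)) (min a (a / (4 * (Q + 1)))), by positivity,
    (4 * L + 2 * Q * C) / a ^ 2, fun p hp r hr hrr => ?_⟩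
  obtain ⟨⟨hrδ, hrη⟩, hra, hrQ⟩ := lt_min_iff.1 hrr |>.imp lt_min_iff.1 lt_min_iff.1
  set x := e p with hx
  set D := fderiv ℝ φ x with hD
  have hpS : ∀ y, ‖ι y - ι p‖ ≤ r → y ∈ e.source ∧ e y ∈ Metric.ball (e p₀) (min R η) := by
    intro y hy
    refine hδS y ?_
    have h1 : dist (ι p) (ι p₀) < δ / 2 := hp
    have h2 := dist_triangle (ι y) (ι p) (ι p₀)
    rw [dist_eq_norm (ι y) (ι p)] at h2
    linarith
  obtain ⟨hps, hpx⟩ := hpS p (by simpa using hr.le)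
  have hxR : x ∈ Metric.ball (e p₀) R := Metric.ball_subset_ball (min_le_left _ _) hpx
  have hxη : x ∈ Metric.ball (e p₀) η := Metric.ball_subset_ball (min_le_right _ _) hpx
  have hDinj : Function.Injective D := injective_fderiv_chartParam him (hRV hxR)
  have hplane : tangentPlane (d := d) ι p = LinearMap.range D.toLinearMap :=
    tangentPlane_eq_range hs hps
  have hrep : ∀ v q, ‖v‖ < r → IsExp (d := d) ι p v q → q ∈ e.source ∧
      ∃ u s : ℝ → EuclideanSpace ℝ (Fin d), u 0 = x ∧ u 1 = e q ∧ D (s 0) = v ∧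
      (∀ t ∈ Icc (0 : ℝ) 1, SolvesQuadraticODE (geodesicCoeff φ) u s t) ∧
      (∀ t ∈ Icc (0 : ℝ) 1, u t ∈ Metric.ball (e p₀) R) ∧
      ∀ t ∈ Icc (0 : ℝ) 1, ‖s t‖ ≤ r / a := by
    intro v q hv h
    refine ⟨?_, ?_⟩
    · obtain ⟨γ, hγ, h0, hv', h1⟩ := h
      have := hγ.norm_sub_le hs (t := 1) (by simp)
      rw [h0, h1, hv'] at this
      exact (hpS q (this.trans hv.le)).1
    · obtain ⟨u, s, h0, h1, h2, h3, h4, h5⟩ := exists_chart_solution_of_isExp him hb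
        (fun y hy => (hpS y (hy.trans hv.le)).imp_right
          fun h => Metric.ball_subset_ball (min_le_left _ _) h) h
      exact ⟨u, s, h0, h1, h2, h3, h4, fun t ht => (h5 t ht).trans (by gcongr)⟩
  have hρ1 : r / a ≤ 1 := (div_le_one ha).2 hra.le
  have hρQ : Q * (r / a) ≤ 1 / 4 := by
    rw [lt_div_iff₀ (by positivity)] at hrQ
    rw [← mul_div_assoc, div_le_iff₀ ha]
    nlinarith
  have hρ0 : 0 ≤ r / a := by positivity
  -- In coordinates the exponential map minus the identity is `1 / 2`-Lipschitz; `w₁ = w₂` gives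
  -- uniqueness, equal endpoints give injectivity.
  have hcmp : ∀ w₁ w₂ q₁ q₂, ‖D w₁‖ < r → ‖D w₂‖ < r → IsExp (d := d) ι p (D w₁) q₁ →
      IsExp (d := d) ι p (D w₂) q₂ → ‖e q₁ - e q₂ - (w₁ - w₂)‖ ≤ 1 / 2 * ‖w₁ - w₂‖ := by
    intro w₁ w₂ q₁ q₂ h₁ h₂ hq₁ hq₂
    obtain ⟨-, u₁, s₁, h10, h11, h12, h13, h14, h15⟩ := hrep _ _ h₁ hq₁
    obtain ⟨-, u₂, s₂, h20, h21, h22, h23, h24, h25⟩ := hrep _ _ h₂ hq₂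
    have := SolvesQuadraticODE.norm_sub_sub_le hb.coeff_le hb.coeff_sub_le hL hρ1
      (by rw [← hQ]; linarith) h13 h23 h14 h24 h15 h25 (h10.trans h20.symm)
    rw [h11, h21, hDinj h12, hDinj h22] at this
    refine this.trans ?_
    gcongr
    linarith
  -- The second solution is now the constant one at `x`.
  have hbase : ∀ w q, ‖D w‖ < r → IsExp (d := d) ι p (D w) q →
      ‖w‖ ≤ r / a ∧ e q ∈ Metric.ball (e p₀) R ∧
      ‖e q - x - w‖ ≤ 2 * Q * (r / a) * ‖w‖ := by
    intro w q h hq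
    obtain ⟨-, u, s, h10, h11, h12, h13, h14, h15⟩ := hrep _ _ h hq
    have := SolvesQuadraticODE.norm_sub_sub_le hb.coeff_le hb.coeff_sub_le hL hρ1
      (by rw [← hQ]; linarith) h13 (fun t _ => .const _ x t) h14 (fun _ _ => hxR) h15
      (fun _ _ => by simpa using hρ0) h10
    rw [sub_zero, h11, hDinj h12] at this
    refine ⟨?_, ?_, this⟩
    · rw [← hDinj h12]; exact h15 0 (by simp)
    · rw [← h11]; exact h14 1 (by simp)
  have hball : ∀ v ∈ tangentBall (d := d) ι p r, ∃ w, D w = v := by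
    rintro v ⟨hv, -⟩
    rw [hplane] at hv
    exact hv
  have hexist : ∀ w, ‖D w‖ < r → ∃ q, IsExp (d := d) ι p (D w) q := by
    intro w hw
    have hwη : ‖w‖ < η := by
      have := hb.lower x hxR w
      rw [← hD] at this
      by_contra! hcon
      nlinarith
    obtain ⟨u, s, hu0, hs0, hus⟩ := hex x hxη w hwη
    have hIJ : Icc (0 : ℝ) 1 ⊆ Ioo (-1) 2 := fun t ht => ⟨by linarith [ht.1], by linarith [ht.2]⟩
    have hV : ∀ t ∈ Ioo (-1 : ℝ) 2, u t ∈ e.target := fun t ht => hRV (hus t ht).1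
    have hgeo := isGeodesic_of_solvesQuadraticODE him isOpen_Ioo hIJ hV
      (fun t ht => (hus t ht).2.1) (fun t ht => (hus t ht).2.2)
    have z0 : (0 : ℝ) ∈ Ioo (-1 : ℝ) 2 := by norm_num
    refine ⟨e.symm (u 1), _, hgeo, ?_, ?_, rfl⟩
    · rw [Function.comp_apply, hu0, hx, e.left_inv hps]
    · have h1 := (contDiffAt_chartParam hs (hV 0 z0)).hasDerivAt_comp_curve (hus 0 z0).2.2
      rw [(hus 0 z0).2.1.position.deriv, hu0, hs0] at h1
      exact h1.deriv
  refine ⟨?_, ?_, ?_, ?_⟩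
  · intro v hv
    obtain ⟨w, rfl⟩ := hball v hv
    obtain ⟨q, hq⟩ := hexist w hv.2
    refine ⟨q, hq, fun q' hq' => ?_⟩
    have h1 := hcmp w w q' q hv.2 hv.2 hq' hq
    rw [sub_self, norm_zero, mul_zero, sub_zero, norm_le_zero_iff, sub_eq_zero] at h1
    exact e.injOn (hrep _ _ hv.2 hq').1 (hrep _ _ hv.2 hq).1 h1
  · intro v₁ hv₁ v₂ hv₂ h12
    obtain ⟨w₁, rfl⟩ := hball v₁ hv₁
    obtain ⟨w₂, rfl⟩ := hball v₂ hv₂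
    have h1 := hcmp w₁ w₂ _ _ hv₁.2 hv₂.2 (isExp_expMap (hexist w₁ hv₁.2))
      (isExp_expMap (hexist w₂ hv₂.2))
    rw [h12, sub_self, zero_sub, norm_neg] at h1
    have h2 : ‖w₁ - w₂‖ = 0 := le_antisymm (by linarith) (norm_nonneg _)
    rw [sub_eq_zero.1 (norm_eq_zero.1 h2)]
  · set s : Set (EuclideanSpace ℝ (Fin d)) := {w | ‖D w‖ < r} with hsdef
    set f : EuclideanSpace ℝ (Fin d) → EuclideanSpace ℝ (Fin d) :=
      fun w => e (expMap (d := d) ι p (D w)) with hf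
    have hs0 : s ∈ 𝓝 0 := (isOpen_lt D.continuous.norm continuous_const).mem_nhds (by simpa using hr)
    have happ : ApproximatesLinearOn f (ContinuousLinearMap.id ℝ _) s (1 / 2) := by
      intro w₁ h₁ w₂ h₂
      simpa using hcmp w₁ w₂ _ _ h₁ h₂ (isExp_expMap (hexist w₁ h₁)) (isExp_expMap (hexist w₂ h₂))
    -- A perturbation of the identity with Lipschitz constant below 1 is open at interior points; no
    -- smoothness of the exponential map is needed.
    have himg := happ.image_mem_nhds ⟨id, 1, by simp, by simp⟩ hs0
      (Or.inr (by rw [inv_one]; exact NNReal.half_lt_self one_ne_zero))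
    have hf0 : f 0 = e p := by
      have h0 : ‖D 0‖ < r := by simpa using hr
      have := (hbase 0 _ h0 (isExp_expMap (hexist 0 h0))).2.2
      rw [norm_zero, mul_zero, sub_zero, norm_le_zero_iff, sub_eq_zero] at this
      exact this
    rw [hf0] at himg
    filter_upwards [(continuousAt_extChartAt' hps).preimage_mem_nhds himg,
      (isOpen_extChartAt_source p₀).mem_nhds hps] with y hy hys
    obtain ⟨w, hw, hwy⟩ := hy
    refine ⟨D w, ⟨hplane ▸ ⟨w, rfl⟩, hw⟩, ?_⟩
    exact e.injOn (hrep _ _ hw (isExp_expMap (hexist w hw))).1 hys hwy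
  · intro v hv
    obtain ⟨w, rfl⟩ := hball v hv
    set q := expMap (d := d) ι p (D w) with hq
    have hqe : IsExp (d := d) ι p (D w) q := isExp_expMap (hexist w hv.2)
    obtain ⟨hw, hqR, hqw⟩ := hbase w q hv.2 hqe
    have hqs := (hrep _ _ hv.2 hqe).1
    have h1 := hb.norm_image_sub_sub_le (convex_ball _ _)
      (fun z hz => (contDiffAt_chartParam hs (hRV hz)).differentiableAt (by simp)) hxR hqR
    have hιq : φ (e q) = ι q := chartParam_extChartAt hqs
    have hιp : φ x = ι p := chartParam_extChartAt hps
    have h2 : ‖e q - x‖ ≤ 2 * (r / a) := by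
      have h3 := norm_le_norm_sub_add (e q - x) w
      have h4 : 2 * Q * (r / a) * ‖w‖ ≤ 1 / 2 * (r / a) := by
        have : 2 * Q * (r / a) ≤ 1 / 2 := by linarith
        exact mul_le_mul this hw (norm_nonneg _) (by norm_num)
      linarith
    have h3 : ‖D (e q - x - w)‖ ≤ C * (2 * Q * (r / a) * (r / a)) :=
      (D.le_of_opNorm_le (hb.fderiv_le x hxR) _).trans (by gcongr; exact hqw.trans (by gcongr))
    have h4 : L * ‖e q - x‖ * ‖e q - x‖ ≤ L * (2 * (r / a)) * (2 * (r / a)) := by gcongr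
    -- The error splits into the Taylor remainder of the parametrization and the image of the
    -- coordinate error.
    have h5 : ι q - (ι p + D w) = (φ (e q) - φ x - D (e q - x)) + D (e q - x - w) := by
      rw [hιq, hιp, map_sub D (e q - x) w]; abel
    rw [h5]
    refine (norm_add_le _ _).trans ((add_le_add (h1.trans h4) h3).trans (le_of_eq ?_))
    field_simp
    ring

end LocalExponential

/-! ### Representative pairs and affine balls. -/

section RepresentativePairs

variable {d m : ℕ} {M : Type*} [TopologicalSpace M] [ChartedSpace (EuclideanSpace ℝ (Fin d)) M]
  {ι : M → EuclideanSpace ℝ (Fin m)}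

/-- The injective differential makes the tangent plane `d`-dimensional, and an orthonormal basis
supplies the isometry. -/
lemma exists_isRepresentativePair (hι : IsImmersion (𝓡 d) (𝓡 m) ∞ ι) (p : M) (r : ℝ) :
    ∃ A, IsRepresentativePair (d := d) ι r p A := by
  have hfr : Module.finrank ℝ (tangentPlane (d := d) ι p) = d := by
    have := LinearMap.finrank_range_of_inj (f := (mfderiv (𝓡 d) (𝓡 m) ι p :
      EuclideanSpace ℝ (Fin d) →L[ℝ] EuclideanSpace ℝ (Fin m)).toLinearMap)
      (hι.isImmersionAt p).mfderiv_injective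
    exact this.trans (finrank_euclideanSpace_fin (𝕜 := ℝ))
  set e := ((stdOrthonormalBasis ℝ (tangentPlane (d := d) ι p)).reindex (finCongr hfr)).repr.symm
  refine ⟨_, (tangentPlane (d := d) ι p).subtypeₗᵢ.comp e.toLinearIsometry, ?_, rfl⟩
  ext v
  constructor
  · rintro ⟨y, rfl⟩
    exact (e y).2
  · intro hv
    exact ⟨e.symm ⟨v, hv⟩, by simp⟩

lemma affineBall_eq_image_tangentBall {r : ℝ} (hr : 0 < r) {p : M}
    {A : EuclideanSpace ℝ (Fin d) →ₗ[ℝ] EuclideanSpace ℝ (Fin m)}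
    (hA : IsRepresentativePair (d := d) ι r p A) :
    affineBall ι p A = (fun v => ι p + v) '' tangentBall (d := d) ι p r := by
  obtain ⟨T, hT, rfl⟩ := hA
  ext y
  constructor
  · rintro ⟨ε, hε, rfl⟩
    refine ⟨r • T ε, ⟨hT ▸ ⟨r • ε, by simp⟩, ?_⟩, rfl⟩
    rw [norm_smul, T.norm_map, Real.norm_of_nonneg hr.le]
    have : ‖ε‖ < 1 := by simpa using hε
    nlinarith
  · rintro ⟨v, ⟨hv, hvr⟩, rfl⟩
    rw [← hT] at hv
    obtain ⟨ε, rfl⟩ := hv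
    refine ⟨r⁻¹ • ε, ?_, by simp [smul_smul, hr.ne']⟩
    have : ‖ε‖ < r := by simpa using hvr
    rw [mem_ball_zero_iff, norm_smul, norm_inv, Real.norm_of_nonneg hr.le, inv_mul_lt_iff₀ hr]
    simpa using this

end RepresentativePairs

/-! ### From local to global by compactness. -/

theorem theorem4 {d m : ℕ} {M : Type*} [TopologicalSpace M]
    [ChartedSpace (EuclideanSpace ℝ (Fin d)) M] [IsManifold (𝓡 d) ∞ M] [CompactSpace M]
    (ι : M → EuclideanSpace ℝ (Fin m)) (hι : IsSmoothEmbedding (𝓡 d) (𝓡 m) ∞ ι) :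
    ∃ r₀ : ℝ, 0 < r₀ ∧ ∃ err : ℝ → ℝ, err =o[𝓝[>] (0 : ℝ)] (fun r : ℝ => r) ∧
      ∀ r : ℝ, 0 < r → r < r₀ →
        ∃ (k : ℕ) (μ : Fin k → M)
          (A : Fin k → EuclideanSpace ℝ (Fin d) →ₗ[ℝ] EuclideanSpace ℝ (Fin m)),
          -- the exponential map is well defined and injective on the tangent balls
          (∀ i, (∀ v ∈ tangentBall (d := d) ι (μ i) r, ∃! q, IsExp (d := d) ι (μ i) v q) ∧
            InjOn (expMap (d := d) ι (μ i)) (tangentBall (d := d) ι (μ i) r)) ∧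
          (∀ i, IsRepresentativePair (d := d) ι r (μ i) (A i)) ∧
          -- the geodesic balls cover the manifold
          (⋃ i, geodesicBall (d := d) ι (μ i) r) = univ ∧
          -- the local error, pointwise and between sets
          (∀ i, ∀ v ∈ tangentBall (d := d) ι (μ i) r,
            ‖ι (expMap (d := d) ι (μ i) v) - (ι (μ i) + v)‖ ≤ err r) ∧
          (∀ i, Metric.hausdorffEDist (ι '' geodesicBall (d := d) ι (μ i) r)
            (affineBall ι (μ i) (A i)) ≤ ENNReal.ofReal (err r)) ∧
          Metric.hausdorffEDist (range ι) (⋃ i, affineBall ι (μ i) (A i))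
            ≤ ENNReal.ofReal (err r) := by
  choose U hU ρ hρ K hK using exists_nhds_expMap_estimates hι
  -- This finite cover does not depend on `r`; it only fixes `r₀` and `C`.
  obtain ⟨t, -, ht⟩ := isCompact_univ.elim_nhds_subcover U fun x _ => hU x
  obtain ⟨r₀, hr₀ρ, hr₀⟩ : ∃ r₀ : ℝ, (∀ x ∈ t, r₀ < ρ x) ∧ 0 < r₀ :=
    (((eventually_all_finset t).2 fun x _ => nhdsWithin_le_nhds (gt_mem_nhds (hρ x))).and
      (self_mem_nhdsWithin (s := Ioi (0 : ℝ)))).exists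
  obtain ⟨C, hC⟩ : ∃ C : ℝ, ∀ x ∈ t, K x ≤ C :=
    ((eventually_all_finset t).2 fun x _ => eventually_ge_atTop (K x)).exists
  refine ⟨r₀, hr₀, fun r => C * r ^ 2, ?_, fun r hr hrr => ?_⟩
  · have h1 : (fun r : ℝ => r ^ 2) =o[𝓝 0] fun r : ℝ => r := by
      simpa using Asymptotics.isLittleO_pow_pow (𝕜 := ℝ) (m := 1) (n := 2) (by norm_num)
    exact (h1.const_mul_left C).mono nhdsWithin_le_nhds
  have hloc : ∀ p : M, (∀ v ∈ tangentBall (d := d) ι p r, ∃! q, IsExp (d := d) ι p v q) ∧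
      InjOn (expMap (d := d) ι p) (tangentBall (d := d) ι p r) ∧
      geodesicBall (d := d) ι p r ∈ 𝓝 p ∧
      ∀ v ∈ tangentBall (d := d) ι p r,
        ‖ι (expMap (d := d) ι p v) - (ι p + v)‖ ≤ C * r ^ 2 := by
    intro p
    obtain ⟨x, hx, hpx⟩ := mem_iUnion₂.1 (ht (mem_univ p))
    obtain ⟨h1, h2, h3, h4⟩ := hK x p hpx r hr (hrr.trans (hr₀ρ x hx))
    exact ⟨h1, h2, h3, fun v hv => (h4 v hv).trans (by gcongr; exact hC x hx)⟩
  -- The second cover, by the geodesic balls themselves, depends on `r` and provides the skeleton.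
  obtain ⟨s, -, hs⟩ := isCompact_univ.elim_nhds_subcover
    (fun p => geodesicBall (d := d) ι p r) fun p _ => (hloc p).2.2.1
  choose A hA using fun p : M => exists_isRepresentativePair (d := d) hι.isImmersion p r
  have hcover : ⋃ i, geodesicBall (d := d) ι (s.equivFin.symm i : M) r = univ := by
    refine eq_univ_of_forall fun q => ?_
    obtain ⟨x, hx, hq⟩ := mem_iUnion₂.1 (hs (mem_univ q))
    exact mem_iUnion.2 ⟨s.equivFin ⟨x, hx⟩, by simpa using hq⟩
  have hedist : ∀ p : M, ∀ v ∈ tangentBall (d := d) ι p r,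
      edist (ι (expMap (d := d) ι p v)) (ι p + v) ≤ ENNReal.ofReal (C * r ^ 2) := by
    intro p v hv
    rw [edist_dist, dist_eq_norm]
    exact ENNReal.ofReal_le_ofReal ((hloc p).2.2.2 v hv)
  have haff := fun p => affineBall_eq_image_tangentBall hr (hA p)
  refine ⟨s.card, fun i => s.equivFin.symm i, fun i => A (s.equivFin.symm i),
    fun i => ⟨(hloc _).1, (hloc _).2.1⟩, fun i => hA _, hcover, fun i => (hloc _).2.2.2,
    fun i => ?_, ?_⟩
  -- Both Hausdorff bounds pair `Exp(v)` with `p + v`; for the whole manifold, the cover supplies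
  -- the index and `v`.
  · rw [haff]
    refine Metric.hausdorffEDist_le_of_mem_edist ?_ ?_
    · rintro _ ⟨_, ⟨v, hv, rfl⟩, rfl⟩
      exact ⟨_, ⟨v, hv, rfl⟩, hedist _ v hv⟩
    · rintro _ ⟨v, hv, rfl⟩
      exact ⟨_, ⟨_, ⟨v, hv, rfl⟩, rfl⟩, edist_comm (α := EuclideanSpace ℝ (Fin m)) _ _ ▸
        hedist _ v hv⟩
  · refine Metric.hausdorffEDist_le_of_mem_edist ?_ ?_
    · rintro _ ⟨q, rfl⟩
      obtain ⟨i, v, hv, rfl⟩ := mem_iUnion.1 (hcover ▸ mem_univ q)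
      exact ⟨_, mem_iUnion.2 ⟨i, by rw [haff]; exact ⟨v, hv, rfl⟩⟩, hedist _ v hv⟩
    · intro y hy
      obtain ⟨i, hi⟩ := mem_iUnion.1 hy
      rw [haff] at hi
      obtain ⟨v, hv, rfl⟩ := hi
      exact ⟨_, ⟨_, rfl⟩, edist_comm (α := EuclideanSpace ℝ (Fin m)) _ _ ▸ hedist _ v hv⟩
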